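/- Let $\Gamma$ be a finite simple graph and let $R(\Gamma)$ be its right-angled Artin group, i.e. the group generated by the vertices of $\Gamma$ subject to the relations $vw=wv$ for all pairs of adjacent vertices $v,w$. For a group $G$ let $m(G)\in\{1,2,\dots\}\cup\{\infty\}$ be the least $d\ge 1$ such that $G$ embeds in $GL(d,\mathbb F)$ for some field $\mathbb F$, and for $p$ equal to $0$ or a prime let $m_p(G)$ be the least $d\ge 1$ such that $G$ embeds in $GL(d,\mathbb F)$ for some field $\mathbb F$ of characteristic $p$ (in both cases $\infty$ if there is no such $d$). Let $\Gamma'$ be the induced subgraph of $\Gamma$ obtained by deleting every vertex that is adjacent to all other vertices of $\Gamma$. Then the following are equivalent: (i) $m(R(\Gamma))=2$; (ii) $m_p(R(\Gamma))=2$ for every $p$ that is $0$ or a prime; (iii) $\Gamma'$ has at least two connected components, and each connected component of $\Gamma'$ is a complete graph. Moreover, for each single $p$ that is $0$ or a prime, $m_p(R(\Gamma))=2$ if and only if (iii) holds. -/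

import Mathlib

universe w u

/-- The group `G` has a faithful representation of dimension `d` over the field `F`,
that is, an injective homomorphism into `GL(d, F)`. -/
def HasFaithfulRep (G : Type*) [Group G] (F : Type*) [Field F] (d : ℕ) : Prop :=
  ∃ ρ : G →* Matrix.GeneralLinearGroup (Fin d) F, Function.Injective ρ

/-- `m(G)`: the least positive integer `d` such that `G` has a faithful representation of
dimension `d` over some field (of any characteristic), and `⊤` if there is no such `d`.
The fields range over the universe `w`. -/
noncomputable def minDim (G : Type u) [Group G] : ℕ∞ :=
  sInf {x : ℕ∞ | ∃ d : ℕ, x = (d : ℕ∞) ∧ 1 ≤ d ∧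
    ∃ (F : Type w) (_ : Field F), HasFaithfulRep G F d}

/-- `m_p(G)`: the least positive integer `d` such that `G` has a faithful representation of
dimension `d` over some field of characteristic `p`, and `⊤` if there is no such `d`.
The fields range over the universe `w`. -/
noncomputable def minDimChar (p : ℕ) (G : Type u) [Group G] : ℕ∞ :=
  sInf {x : ℕ∞ | ∃ d : ℕ, x = (d : ℕ∞) ∧ 1 ≤ d ∧
    ∃ (F : Type w) (_ : Field F) (_ : CharP F p), HasFaithfulRep G F d}

/-- The defining relators of the right-angled Artin group: one commutator for each pair of
adjacent vertices. -/
def raagRels {V : Type*} (Γ : SimpleGraph V) : Set (FreeGroup V) :=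
  {r | ∃ v w : V, Γ.Adj v w ∧
    r = FreeGroup.of v * FreeGroup.of w * (FreeGroup.of v)⁻¹ * (FreeGroup.of w)⁻¹}

/-- The right-angled Artin group `R(Γ)`: generated by the vertices of `Γ`, where adjacent
vertices commute. -/
abbrev RAAG {V : Type*} (Γ : SimpleGraph V) : Type _ :=
  PresentedGroup (raagRels Γ)

/-- The graph that remains after all vertices adjacent to every other vertex are deleted
(together with their incident edges). -/
abbrev deleteUniversal {V : Type*} (Γ : SimpleGraph V) :
    SimpleGraph ↥(Γ.universalVertsᶜ) :=
  Γ.induce Γ.universalVertsᶜ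

/-- The graph `H` has at least two connected components, and any two distinct vertices of the
same component are adjacent. -/
def TwoOrMoreCompleteComponents {W : Type*} (H : SimpleGraph W) : Prop :=
  2 ≤ ENat.card H.ConnectedComponent ∧ ∀ c : H.ConnectedComponent, H.IsClique c.supp

/-!
In dimension two, an element that commutes with two noncommuting elements acts by a scalar, so it
is central. The central vertices of `R(Γ)` are the universal ones, so when `R(Γ)` embeds in `GL₂`,
adjacency of distinct vertices of `Γ'` is transitive, and the components of `Γ'` are complete.

Conversely, if the components of `Γ'` are complete, `R(Γ)` is the direct product of a free abelian
group on the universal vertices and the free product of free abelian groups on the components. Over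
a field `K` with many multiplicatively independent elements, let the component `D` act on `K(X)²`
through a torus whose elements other than `±1` send the directions `d + O(1/X)` with `d ≠ c(D)` to
directions `c(D) + O(1/X)`. With distinct parameters for distinct components, ping-pong makes the
action of the free product faithful. The tori lie in `SL₂`, so letting the universal vertices act by
scalars keeps the action faithful: the determinant detects the scalars up to sign.
-/

section Independence

theorem linearIndependent_const_smul {R M ι : Type*} [CommRing R] [IsDomain R] [AddCommGroup M]
    [Module R M] {v : ι → M} (hv : LinearIndependent R v) {a : R} (ha : a ≠ 0) :
    LinearIndependent R (a • v) := by
  rw [linearIndependent_iff] at hv ⊢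
  intro l hl
  have hal : a • l = 0 := hv _ <| by
    rw [map_smul, ← hl]
    simp only [Finsupp.linearCombination_apply, Finsupp.sum, Finset.smul_sum, Pi.smul_apply,
      smul_comm a]
  exact (smul_eq_zero.mp hal).resolve_left ha

open scoped IsMulCommutative in
theorem injOn_closure_of_linearIndependent {G A ι : Type*} [Group G] [CommGroup A] {s : ι → G}
    (hs : ∀ i j, Commute (s i) (s j)) {f : G →* A}
    (hf : LinearIndependent ℤ (Additive.ofMul ∘ f ∘ s)) :
    Set.InjOn f (Subgroup.closure (Set.range s)) := by
  set H := Subgroup.closure (Set.range s)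
  have : IsMulCommutative H :=
    Subgroup.isMulCommutative_closure <|
      Set.forall_mem_range.2 fun i => Set.forall_mem_range.2 (hs i)
  let σ : ι → Additive H := fun i =>
    Additive.ofMul ⟨s i, Subgroup.subset_closure (Set.mem_range_self i)⟩
  let φ : Additive H →ₗ[ℤ] Additive A := (f.comp H.subtype).toAdditive.toIntLinearMap
  have hspan : ∀ x (hx : x ∈ H), Additive.ofMul ⟨x, hx⟩ ∈ Submodule.span ℤ (Set.range σ) := by
    intro x hx
    induction hx using Subgroup.closure_induction with
    | mem _ h => obtain ⟨i, rfl⟩ := h; exact Submodule.subset_span (Set.mem_range_self i)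
    | one => exact zero_mem _
    | mul _ _ _ _ hx hy => exact add_mem hx hy
    | inv _ _ hx => exact neg_mem hx
  have hker : Disjoint (Submodule.span ℤ (Set.range σ)) φ.ker := Submodule.range_ker_disjoint hf
  have hinj : Function.Injective (f.comp H.subtype) := by
    rw [injective_iff_map_eq_one]
    intro x hx
    exact Submodule.disjoint_def.1 hker _ (hspan x.1 x.2) hx
  exact fun x hx y hy hxy => congrArg Subtype.val (@hinj ⟨x, hx⟩ ⟨y, hy⟩ hxy)

theorem eq_one_of_mem_closure_of_pow_eq_one {G A ι : Type*} [Group G] [CommGroup A] {s : ι → G}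
    (hs : ∀ i j, Commute (s i) (s j)) {f : G →* A}
    (hf : LinearIndependent ℤ (Additive.ofMul ∘ f ∘ s)) {x : G}
    (hx : x ∈ Subgroup.closure (Set.range s)) {n : ℕ} (hn : n ≠ 0) (hfx : f x ^ n = 1) : x = 1 := by
  have hfn : LinearIndependent ℤ (Additive.ofMul ∘ ((powMonoidHom n).comp f) ∘ s) := by
    have hsmul : Additive.ofMul ∘ ((powMonoidHom n).comp f) ∘ s =
        (n : ℤ) • (Additive.ofMul ∘ f ∘ s) := by ext i; simp
    rw [hsmul]
    exact linearIndependent_const_smul hf (Int.natCast_ne_zero.2 hn)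
  exact injOn_closure_of_linearIndependent hs hfn hx (one_mem _) (by simpa using hfx)

open AddMonoidAlgebra in
theorem exists_linearIndependent_units_fractionRing (k σ : Type*) [Field k] :
    ∃ t : σ → (FractionRing k[σ →₀ ℤ])ˣ, LinearIndependent ℤ (Additive.ofMul ∘ t) := by
  let K := FractionRing k[σ →₀ ℤ]
  let monomial : Multiplicative (σ →₀ ℤ) →* Kˣ :=
    ((algebraMap k[σ →₀ ℤ] K).toMonoidHom.comp (of k (σ →₀ ℤ))).toHomUnits
  have hmonomial : Function.Injective monomial := fun x y h =>
    of_injective (IsFractionRing.injective k[σ →₀ ℤ] K (congrArg Units.val h))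
  let exponents : (σ →₀ ℤ) →ₗ[ℤ] Additive Kˣ := (MonoidHom.toAdditiveRight monomial).toIntLinearMap
  exact ⟨fun s => monomial (.ofAdd (Finsupp.single s 1)),
    (Finsupp.linearIndependent_single_one ℤ σ).map' exponents (LinearMap.ker_eq_bot.2 hmonomial)⟩

theorem exists_field_charP {p : ℕ} (hp : p = 0 ∨ p.Prime) :
    ∃ (k : Type) (_ : Field k), CharP k p := by
  rcases hp with rfl | hp
  · exact ⟨ℚ, inferInstance, inferInstance⟩
  · have := Fact.mk hp
    exact ⟨ZMod p, inferInstance, inferInstance⟩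

theorem exists_field_linearIndependent_units (V : Type u) [Small.{w} V] {p : ℕ}
    (hp : p = 0 ∨ p.Prime) :
    ∃ (K : Type w) (_ : Field K) (_ : CharP K p) (t : V → Kˣ),
      LinearIndependent ℤ (Additive.ofMul ∘ t) := by
  obtain ⟨k, _, _⟩ := exists_field_charP hp
  obtain ⟨t, ht⟩ := exists_linearIndependent_units_fractionRing k (Shrink.{w} V)
  exact ⟨_, inferInstance, charP_of_injective_algebraMap (algebraMap k _).injective p,
    t ∘ equivShrink V, ht.comp _ (equivShrink V).injective⟩

end Independence

section PlaneEndomorphisms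

variable {F V : Type*} [Field F] [AddCommGroup V] [Module F V] {f g h : Module.End F V}

theorem exists_eq_smul_one_add_smul_of_commute (hV : Module.finrank F V = 2)
    (hf : ∀ a : F, f ≠ a • 1) (hfg : Commute f g) : ∃ a b : F, g = a • 1 + b • f := by
  obtain ⟨v, hv⟩ : ∃ v, LinearIndependent F ![v, f v] := by
    by_contra! hdep
    obtain ⟨a, ha⟩ := LinearMap.exists_eq_smul_id_of_forall_notLinearIndependent hdep
    exact hf a ha
  let cyclicBasis := basisOfLinearIndependentOfCardEqFinrank hv (by simp [hV])
  obtain ⟨a, b, hgv⟩ : ∃ a b : F, g v = a • v + b • f v :=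
    ⟨cyclicBasis.repr (g v) 0, cyclicBasis.repr (g v) 1, by
      simpa [cyclicBasis, Fin.sum_univ_two] using (cyclicBasis.sum_repr (g v)).symm⟩
  refine ⟨a, b, cyclicBasis.ext fun i => ?_⟩
  have hgfv : g (f v) = f (g v) := (LinearMap.congr_fun hfg v).symm
  fin_cases i <;> simp [cyclicBasis, hgv, hgfv]

theorem commute_of_commute_of_ne_smul_one (hV : Module.finrank F V = 2)
    (hf : ∀ a : F, f ≠ a • 1) (hfg : Commute f g) (hfh : Commute f h) : Commute g h := by
  obtain ⟨a, b, rfl⟩ := exists_eq_smul_one_add_smul_of_commute hV hf hfg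
  exact ((Commute.one_left h).smul_left a).add_left (hfh.smul_left b)

end PlaneEndomorphisms

section FaithfulRep

open Matrix

variable {G : Type*} [Group G] {F : Type*} [Field F]

theorem hasFaithfulRep_one_iff :
    HasFaithfulRep G F 1 ↔ ∃ χ : G →* Fˣ, Function.Injective χ := by
  have hdet : Function.Injective (GeneralLinearGroup.det : GL (Fin 1) F →* Fˣ) := fun A B h => by
    ext i j
    simpa [Subsingleton.elim i 0, Subsingleton.elim j 0] using congrArg Units.val h
  have hscalar : Function.LeftInverse GeneralLinearGroup.det
      (GeneralLinearGroup.scalar (Fin 1) : Fˣ →* GL (Fin 1) F) := fun a => by simp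
  exact ⟨fun ⟨ρ, hρ⟩ => ⟨GeneralLinearGroup.det.comp ρ, hdet.comp hρ⟩,
    fun ⟨χ, hχ⟩ => ⟨(GeneralLinearGroup.scalar (Fin 1)).comp χ, hscalar.injective.comp hχ⟩⟩

theorem HasFaithfulRep.commute (hG : HasFaithfulRep G F 1) (x y : G) : Commute x y := by
  obtain ⟨χ, hχ⟩ := hasFaithfulRep_one_iff.1 hG
  exact Commute.of_map hχ (Commute.all _ _)

theorem HasFaithfulRep.mem_center_of_commute_of_not_commute (hG : HasFaithfulRep G F 2) {a b c : G}
    (hba : Commute b a) (hbc : Commute b c) (hac : ¬ Commute a c) : b ∈ Subgroup.center G := by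
  obtain ⟨ρ, hρ⟩ := hG
  let φ : G →* Module.End F (Fin 2 → F) :=
    (Matrix.toLinAlgEquiv' : Matrix (Fin 2) (Fin 2) F ≃ₐ[F] _).toMonoidHom.comp
      ((Units.coeHom _).comp ρ)
  have hφ : Function.Injective φ :=
    Matrix.toLinAlgEquiv'.injective.comp (Units.val_injective.comp hρ)
  obtain ⟨r, hr⟩ : ∃ r : F, φ b = r • 1 := by
    by_contra! hb
    exact hac <| Commute.of_map hφ <|
      commute_of_commute_of_ne_smul_one (by simp) hb (hba.map φ) (hbc.map φ)
  refine Subgroup.mem_center_iff.2 fun d => Commute.of_map hφ ?_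
  rw [hr]
  exact (Commute.one_right _).smul_right r

theorem hasFaithfulRep_fractionRing {R : Type*} [CommRing R] [IsDomain R] {d : ℕ}
    {ρ : G →* GL (Fin d) R} (hρ : Function.Injective ρ) : HasFaithfulRep G (FractionRing R) d :=
  ⟨(GeneralLinearGroup.map (algebraMap R (FractionRing R))).comp ρ,
    (Units.map_injective (Matrix.map_injective (IsFractionRing.injective R _))).comp hρ⟩

end FaithfulRep

section CompleteComponents

theorem isClique_supp_of_adj_trans {W : Type*} {H : SimpleGraph W}
    (hH : ∀ a b c, H.Adj a b → H.Adj b c → a ≠ c → H.Adj a c) (C : H.ConnectedComponent) :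
    H.IsClique C.supp := by
  have adj_of_walk : ∀ {a b : W}, H.Walk a b → a ≠ b → H.Adj a b := by
    intro a b p
    induction p with
    | nil => exact fun h => absurd rfl h
    | @cons a b c hab _ ih =>
      intro hac
      rcases eq_or_ne b c with rfl | hbc
      · exact hab
      · exact hH a b c hab (ih hbc) hac
  intro a ha b hb hab
  obtain ⟨p⟩ := SimpleGraph.ConnectedComponent.exact (ha.trans hb.symm)
  exact adj_of_walk p hab

variable {V : Type*} {Γ : SimpleGraph V}

theorem nontrivial_connectedComponent_deleteUniversal_iff
    (hΓ : ∀ C : (deleteUniversal Γ).ConnectedComponent, (deleteUniversal Γ).IsClique C.supp) :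
    Nontrivial (deleteUniversal Γ).ConnectedComponent ↔ Γ ≠ ⊤ := by
  constructor
  · rintro ⟨C, -⟩ rfl
    obtain ⟨⟨v, hv⟩, -⟩ := C.nonempty_supp
    exact hv fun w hvw => hvw
  · intro hne
    obtain ⟨a, b, hab, hadj⟩ := SimpleGraph.ne_top_iff_exists_not_adj.1 hne
    have ha : a ∈ Γ.universalVertsᶜ := fun h => hadj (h hab)
    have hb : b ∈ Γ.universalVertsᶜ := fun h => hadj (h hab.symm).symm
    exact ⟨(deleteUniversal Γ).connectedComponentMk ⟨a, ha⟩,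
      (deleteUniversal Γ).connectedComponentMk ⟨b, hb⟩, fun h =>
        hadj (hΓ _ h rfl fun e => hab (congrArg Subtype.val e))⟩

theorem twoOrMoreCompleteComponents_deleteUniversal_iff :
    TwoOrMoreCompleteComponents (deleteUniversal Γ) ↔ Γ ≠ ⊤ ∧
      ∀ C : (deleteUniversal Γ).ConnectedComponent, (deleteUniversal Γ).IsClique C.supp := by
  refine and_congr_left fun hΓ => ?_
  rw [← nontrivial_connectedComponent_deleteUniversal_iff hΓ, ← ENat.one_lt_card_iff_nontrivial,
    ← one_add_one_eq_two, ENat.add_one_le_iff ENat.one_ne_top]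

end CompleteComponents

namespace RAAG

variable {V : Type*} {Γ : SimpleGraph V} {G : Type*} [Group G]

/-- The generator of `R(Γ)` given by a vertex. -/
abbrev gen (Γ : SimpleGraph V) (v : V) : RAAG Γ := PresentedGroup.of v

theorem gen_commute {v w : V} (h : Γ.Adj v w) : Commute (gen Γ v) (gen Γ w) :=
  commutatorElement_eq_one_iff_commute.1 (PresentedGroup.one_of_mem ⟨v, w, h, rfl⟩)

theorem gen_commute_of_isClique {S : Set V} (hS : Γ.IsClique S) (v w : S) :
    Commute (gen Γ v) (gen Γ w) := by
  rcases eq_or_ne v w with rfl | h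
  · exact Commute.refl _
  · exact gen_commute (hS v.2 w.2 (Subtype.coe_ne_coe.2 h))

/-- The universal property of `R(Γ)`: a map on vertices that sends adjacent vertices to commuting
elements extends to a homomorphism. -/
def lift (f : V → G) (hf : ∀ v w, Γ.Adj v w → Commute (f v) (f w)) : RAAG Γ →* G :=
  PresentedGroup.toGroup (f := f) <| by
    rintro _ ⟨v, w, h, rfl⟩
    simpa [commutatorElement_def] using commutatorElement_eq_one_iff_commute.2 (hf v w h)

@[simp]
theorem lift_gen (f : V → G) (hf : ∀ v w, Γ.Adj v w → Commute (f v) (f w)) (v : V) :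
    lift f hf (gen Γ v) = f v :=
  PresentedGroup.toGroup.of _

theorem mem_center_of_forall_commute_gen {x : RAAG Γ} (h : ∀ v, Commute (gen Γ v) x) :
    x ∈ Subgroup.center (RAAG Γ) := by
  rw [← Subgroup.centralizer_univ, ← Subgroup.coe_top, ← PresentedGroup.closure_range_of,
    Subgroup.centralizer_closure]
  exact Subgroup.mem_centralizer_iff.2 (Set.forall_mem_range.2 h)

theorem not_commute_gen {v w : V} (hne : v ≠ w) (h : ¬ Γ.Adj v w) :
    ¬ Commute (gen Γ v) (gen Γ w) := by
  classical
  let f : V → Equiv.Perm (Fin 3) := fun x =>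
    if x = v then Equiv.swap 0 1 else if x = w then Equiv.swap 1 2 else 1
  have hf : ∀ x y, Γ.Adj x y → Commute (f x) (f y) := by
    intro x y hxy
    have hone : f x = 1 ∨ f y = 1 := by
      have hne_xy := hxy.ne
      have hyx := hxy.symm
      grind
    rcases hone with hx | hy
    · exact hx ▸ Commute.one_left _
    · exact hy ▸ Commute.one_right _
  intro hc
  have hswap : Commute (Equiv.swap 0 1) (Equiv.swap 1 2 : Equiv.Perm (Fin 3)) := by
    simpa [f, hne.symm] using hc.map (lift f hf)
  revert hswap
  unfold Commute SemiconjBy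
  decide

theorem gen_mem_center_iff {v : V} :
    gen Γ v ∈ Subgroup.center (RAAG Γ) ↔ v ∈ Γ.universalVerts := by
  refine ⟨fun h w hvw => ?_, fun h => mem_center_of_forall_commute_gen fun w => ?_⟩
  · by_contra hadj
    exact not_commute_gen hvw hadj (Subgroup.mem_center_iff.1 h _).symm
  · rcases eq_or_ne v w with rfl | hvw
    · exact Commute.refl _
    · exact (gen_commute (h hvw)).symm

/-- The subgroup of `R(Γ)` generated by a set of vertices. -/
def vertexSubgroup (Γ : SimpleGraph V) (S : Set V) : Subgroup (RAAG Γ) :=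
  Subgroup.closure (gen Γ '' S)

theorem vertexSubgroup_universalVerts_le_center :
    vertexSubgroup Γ Γ.universalVerts ≤ Subgroup.center (RAAG Γ) :=
  (Subgroup.closure_le _).2 (Set.forall_mem_image.2 fun _ hv => gen_mem_center_iff.2 hv)

section Character

variable {A : Type*} [CommGroup A]

/-- The homomorphism from `R(Γ)` to a commutative group with prescribed values on the vertices. -/
def character (Γ : SimpleGraph V) (t : V → A) : RAAG Γ →* A :=
  lift t fun _ _ _ => Commute.all _ _

theorem eq_one_of_character_pow_eq_one {t : V → A}
    (ht : LinearIndependent ℤ (Additive.ofMul ∘ t)) {S : Set V} (hS : Γ.IsClique S) {x : RAAG Γ}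
    (hx : x ∈ vertexSubgroup Γ S) {n : ℕ} (hn : n ≠ 0) (hxn : character Γ t x ^ n = 1) :
    x = 1 := by
  rw [vertexSubgroup, Set.image_eq_range] at hx
  refine eq_one_of_mem_closure_of_pow_eq_one (gen_commute_of_isClique hS) ?_ hx hn hxn
  convert ht.comp _ Subtype.val_injective using 1
  ext v
  simp [character]

end Character

end RAAG

section PingPong

theorem three_le_mk_of_forall_sq_eq_one {G : Type*} [Group G] [Nontrivial G]
    (hG : ∀ x : G, x ^ 2 = 1 → x = 1) : 3 ≤ Cardinal.mk G := by
  obtain ⟨x, hx⟩ := exists_ne (1 : G)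
  have hinv : x ≠ x⁻¹ := fun h => hx (hG x (by rw [sq, mul_eq_one_iff_eq_inv.2 h]))
  have hinj : Function.Injective ![1, x, x⁻¹] := by
    intro i j
    fin_cases i <;> fin_cases j <;> simp [hx, hx.symm, hinv, hinv.symm]
  simpa using Cardinal.lift_mk_le_lift_mk_of_injective hinj

theorem smul_add_smul_one_sub_mul {R A : Type*} [CommRing R] [Ring A] [Algebra R A] {e : A}
    (he : IsIdempotentElem e) (a b c d : R) :
    (a • e + b • (1 - e)) * (c • e + d • (1 - e)) = (a * c) • e + (b * d) • (1 - e) := by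
  simp [add_mul, mul_add, smul_smul, he.eq, he.one_sub.eq, he.mul_one_sub_self,
    he.one_sub_mul_self, mul_comm]

open Polynomial Matrix

variable {K : Type*} [Field K]

/-- The projection of rank one of `K[X]²` with kernel spanned by `(c, 1)` and image spanned by
`(1 + c X, X)`. -/
noncomputable def pencilProjection (c : K) : Matrix (Fin 2) (Fin 2) K[X] :=
  vecMulVec ![1 + C c * X, X] ![1, -C c]

theorem pencilProjection_mulVec (c : K) (v : Fin 2 → K[X]) :
    pencilProjection c *ᵥ v = (v 0 - C c * v 1) • ![1 + C c * X, X] := by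
  rw [pencilProjection, vecMulVec_mulVec, op_smul_eq_smul]
  simp [dotProduct, sub_eq_add_neg]

theorem isIdempotentElem_pencilProjection (c : K) : IsIdempotentElem (pencilProjection c) := by
  rw [IsIdempotentElem, pencilProjection, vecMulVec_mul_vecMulVec]
  congr
  simp [dotProduct]

theorem det_smul_pencilProjection_add (c : K) (f g : K[X]) :
    (f • pencilProjection c + g • (1 - pencilProjection c)).det = f * g := by
  simp only [det_fin_two, Matrix.add_apply, Matrix.smul_apply, Matrix.sub_apply, smul_eq_mul,
    pencilProjection, vecMulVec_apply, cons_val_zero, cons_val_one, one_apply_eq, ne_eq,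
    zero_ne_one, one_ne_zero, not_false_eq_true, one_apply_ne]
  ring

/-- The torus in `SL₂(K[X])` of the matrices with eigenvalue `a` on the image of
`pencilProjection c` and `a⁻¹` on its kernel. -/
noncomputable def torus (c : K) : Kˣ →* SpecialLinearGroup (Fin 2) K[X] where
  toFun a := ⟨C (a : K) • pencilProjection c + C (↑a⁻¹ : K) • (1 - pencilProjection c), by
    rw [det_smul_pencilProjection_add, ← C_mul, Units.mul_inv, C_1]⟩
  map_one' := Subtype.ext (by simp)
  map_mul' a b := Subtype.ext <| by
    refine .trans ?_ (smul_add_smul_one_sub_mul (isIdempotentElem_pencilProjection c) ..).symm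
    simp only [mul_inv, Units.val_mul, C_mul]

theorem torus_val (c : K) (a : Kˣ) : (torus c a).val =
    C (a : K) • pencilProjection c + C (↑a⁻¹ : K) • (1 - pencilProjection c) :=
  rfl

theorem torus_mulVec (c : K) (a : Kˣ) (v : Fin 2 → K[X]) :
    (torus c a).val *ᵥ v = C (↑a⁻¹ : K) • v +
      (C ((a : K) - (↑a⁻¹ : K)) * (v 0 - C c * v 1)) • ![1 + C c * X, X] := by
  rw [torus_val, add_mulVec, smul_mulVec, smul_mulVec, sub_mulVec, one_mulVec,
    pencilProjection_mulVec, C_sub]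
  module

/-- The vectors `(f, g)` for which `f / g` tends to `c` as `X` tends to infinity. The strict
inequality of degrees includes `g ≠ 0`. -/
def attractingSet (c : K) : Set (Fin 2 → K[X]) :=
  {v | (v 0 - C c * v 1).degree < (v 1).degree}

theorem nonempty_attractingSet (c : K) : (attractingSet c).Nonempty :=
  ⟨![C c, 1], by simp [attractingSet]⟩

theorem degree_sub_eq_of_mem_attractingSet {c d : K} (hcd : c ≠ d) {v : Fin 2 → K[X]}
    (hv : v ∈ attractingSet d) : (v 0 - C c * v 1).degree = (v 1).degree := by
  have hsplit : v 0 - C c * v 1 = (v 0 - C d * v 1) + C (d - c) * v 1 := by rw [C_sub]; ring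
  have hdeg : (C (d - c) * v 1).degree = (v 1).degree := degree_C_mul (sub_ne_zero.2 hcd.symm)
  rw [hsplit, degree_add_eq_right_of_degree_lt (hdeg.symm ▸ hv), hdeg]

theorem disjoint_attractingSet {c d : K} (hcd : c ≠ d) :
    Disjoint (attractingSet c) (attractingSet d) :=
  Set.disjoint_left.2 fun _ hc hd => hc.ne (degree_sub_eq_of_mem_attractingSet hcd hd)

theorem torus_mulVec_mem_attractingSet {c d : K} (hcd : c ≠ d) {a : Kˣ} (ha : a ^ 2 ≠ 1)
    {v : Fin 2 → K[X]} (hv : v ∈ attractingSet d) :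
    (torus c a).val *ᵥ v ∈ attractingSet c := by
  set f := v 0 - C c * v 1 with hf
  have hfdeg : f.degree = (v 1).degree := degree_sub_eq_of_mem_attractingSet hcd hv
  have haa : (a : K) - (↑a⁻¹ : K) ≠ 0 := fun h => ha <| by
    rw [sq, mul_eq_one_iff_eq_inv]
    exact Units.ext (sub_eq_zero.1 h)
  have hdiff : ((torus c a).val *ᵥ v) 0 - C c * ((torus c a).val *ᵥ v) 1 = C (a : K) * f := by
    rw [torus_mulVec]
    simp only [hf, C_sub, Pi.add_apply, Pi.smul_apply, smul_eq_mul, cons_val_zero, cons_val_one]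
    ring
  have hsnd : ((torus c a).val *ᵥ v) 1 =
      C (↑a⁻¹ : K) * v 1 + C ((a : K) - (↑a⁻¹ : K)) * (f * X) := by
    rw [torus_mulVec]
    simp [hf, mul_assoc, -Units.val_inv_eq_inv_val]
  have hlt : (v 1).degree < (v 1).degree + 1 := by
    rw [degree_eq_natDegree (ne_zero_of_degree_gt hv)]
    exact_mod_cast Nat.lt_succ_self _
  have hsnd_deg : (((torus c a).val *ᵥ v) 1).degree = (v 1).degree + 1 := by
    have hX : (C ((a : K) - (↑a⁻¹ : K)) * (f * X)).degree = (v 1).degree + 1 := by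
      rw [degree_C_mul haa, degree_mul_X, hfdeg]
    rw [hsnd, degree_add_eq_right_of_degree_lt, hX]
    rwa [hX, degree_C_mul a⁻¹.ne_zero]
  rwa [attractingSet, Set.mem_ofPred_eq, hdiff, degree_C_mul a.ne_zero, hfdeg, hsnd_deg]

theorem coprodI_lift_torus_injective {ι : Type*} [Nontrivial ι] {H : ι → Type*} [∀ i, Group (H i)]
    [∀ i, Nontrivial (H i)] {c : ι → K} (hc : Function.Injective c) (χ : ∀ i, H i →* Kˣ)
    (hχ : ∀ i x, χ i x ^ 2 = 1 → x = 1) :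
    Function.Injective (Monoid.CoprodI.lift fun i => (torus (c i)).comp (χ i)) := by
  let : MulAction (SpecialLinearGroup (Fin 2) K[X]) (Fin 2 → K[X]) :=
    { smul g v := g.val *ᵥ v
      one_smul := one_mulVec
      mul_smul g h v := (mulVec_mulVec v g.val h.val).symm }
  obtain ⟨i₀⟩ := (inferInstance : Nonempty ι)
  have hcard : 3 ≤ Cardinal.mk (H i₀) :=
    three_le_mk_of_forall_sq_eq_one fun x hx => hχ i₀ x (by rw [← map_pow, hx, map_one])
  refine Monoid.CoprodI.lift_injective_of_ping_pong _ (Or.inr ⟨i₀, hcard⟩)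
    (fun i => attractingSet (c i)) (fun i => nonempty_attractingSet _)
    (fun i j hij => disjoint_attractingSet (hc.ne hij)) ?_
  rintro i j hij x hx _ ⟨v, hv, rfl⟩
  exact torus_mulVec_mem_attractingSet (hc.ne hij) (mt (hχ i x) hx) hv

end PingPong

namespace RAAG

section Decomposition

variable {V : Type*} {Γ : SimpleGraph V} (C : (deleteUniversal Γ).ConnectedComponent)

/-- The vertices of a connected component of `Γ'`, as a set of vertices of `Γ`. -/
def componentVerts : Set V := Subtype.val '' C.supp

variable {C}

theorem isClique_componentVerts (hC : (deleteUniversal Γ).IsClique C.supp) :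
    Γ.IsClique (componentVerts C) := by
  rintro _ ⟨v, hv, rfl⟩ _ ⟨w, hw, rfl⟩ hvw
  exact hC hv hw (Subtype.coe_ne_coe.1 hvw)

theorem mem_componentVerts_mk {v : V} (hv : v ∈ Γ.universalVertsᶜ) :
    v ∈ componentVerts ((deleteUniversal Γ).connectedComponentMk ⟨v, hv⟩) :=
  ⟨⟨v, hv⟩, rfl, rfl⟩

/-- The homomorphism to `R(Γ)` from the free product of the subgroups that belong to the
components of `Γ'`. -/
def freeProductHom (Γ : SimpleGraph V) :
    Monoid.CoprodI (fun C : (deleteUniversal Γ).ConnectedComponent =>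
      vertexSubgroup Γ (componentVerts C)) →* RAAG Γ :=
  Monoid.CoprodI.lift fun _ => Subgroup.subtype _

theorem exists_mul_freeProductHom_eq (x : RAAG Γ) :
    ∃ z ∈ vertexSubgroup Γ Γ.universalVerts, ∃ g, z * freeProductHom Γ g = x := by
  have hnormal : (vertexSubgroup Γ Γ.universalVerts).Normal :=
    ⟨fun z hz y => by
      rwa [Subgroup.mem_center_iff.1 (vertexSubgroup_universalVerts_le_center hz) y,
        mul_inv_cancel_right]⟩
  have hgen : ⊤ ≤ vertexSubgroup Γ Γ.universalVerts ⊔ (freeProductHom Γ).range := by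
    rw [← PresentedGroup.closure_range_of, Subgroup.closure_le]
    rintro _ ⟨v, rfl⟩
    by_cases hv : v ∈ Γ.universalVerts
    · exact Subgroup.mem_sup_left (Subgroup.subset_closure ⟨v, hv, rfl⟩)
    · exact Subgroup.mem_sup_right ⟨Monoid.CoprodI.of
        ⟨gen Γ v, Subgroup.subset_closure ⟨v, mem_componentVerts_mk hv, rfl⟩⟩,
          Monoid.CoprodI.lift_of ..⟩
  obtain ⟨z, hz, _, ⟨g, rfl⟩, hx⟩ :=
    Subgroup.mem_sup_of_normal_left.1 (hgen (Subgroup.mem_top x))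
  exact ⟨z, hz, g, hx⟩

end Decomposition

section Representation

open Polynomial Matrix

variable {V : Type*} {Γ : SimpleGraph V} {K : Type*} [Field K]
  (c : (deleteUniversal Γ).ConnectedComponent → K) (t : V → Kˣ)

open Classical in
/-- The image of a vertex under `polyRep`: a scalar matrix for a universal vertex, and otherwise an
element of the torus that belongs to the component of the vertex. -/
noncomputable def vertexMatrix (v : V) : GL (Fin 2) K[X] :=
  if h : v ∈ Γ.universalVertsᶜ then
    SpecialLinearGroup.toGL
      (torus (c ((deleteUniversal Γ).connectedComponentMk ⟨v, h⟩)) (t v))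
  else GeneralLinearGroup.scalar (Fin 2) (Units.map (C : K →+* K[X]).toMonoidHom (t v))

theorem vertexMatrix_of_mem_universalVerts {v : V} (hv : v ∈ Γ.universalVerts) :
    vertexMatrix c t v =
      GeneralLinearGroup.scalar (Fin 2) (Units.map (C : K →+* K[X]).toMonoidHom (t v)) :=
  dif_neg (by simpa using hv)

theorem vertexMatrix_of_mem_componentVerts {D : (deleteUniversal Γ).ConnectedComponent} {v : V}
    (hv : v ∈ componentVerts D) :
    vertexMatrix c t v = SpecialLinearGroup.toGL (torus (c D) (t v)) := by
  obtain ⟨⟨v, hv⟩, rfl, rfl⟩ := hv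
  exact dif_pos hv

theorem vertexMatrix_commute {v w : V} (hvw : Γ.Adj v w) :
    Commute (vertexMatrix c t v) (vertexMatrix c t w) := by
  by_cases hv : v ∈ Γ.universalVerts
  · rw [vertexMatrix_of_mem_universalVerts c t hv]
    exact GeneralLinearGroup.scalar_commute _ _
  by_cases hw : w ∈ Γ.universalVerts
  · rw [vertexMatrix_of_mem_universalVerts c t hw]
    exact (GeneralLinearGroup.scalar_commute _ _).symm
  have hadj : (deleteUniversal Γ).Adj ⟨w, hw⟩ ⟨v, hv⟩ := hvw.symm
  have hw' : w ∈ componentVerts ((deleteUniversal Γ).connectedComponentMk ⟨v, hv⟩) :=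
    ⟨⟨w, hw⟩, SimpleGraph.ConnectedComponent.sound hadj.reachable, rfl⟩
  rw [vertexMatrix_of_mem_componentVerts c t (mem_componentVerts_mk hv),
    vertexMatrix_of_mem_componentVerts c t hw']
  exact ((Commute.all (t v) (t w)).map (torus _)).map SpecialLinearGroup.toGL

/-- The representation of `R(Γ)` over `K[X]` in which the subgroup of each component `D` of `Γ'`
acts through the torus of parameter `c D`, and universal vertices act by scalars. -/
noncomputable def polyRep : RAAG Γ →* GL (Fin 2) K[X] :=
  lift (vertexMatrix c t) fun _ _ => vertexMatrix_commute c t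

theorem polyRep_eq_scalar {z : RAAG Γ} (hz : z ∈ vertexSubgroup Γ Γ.universalVerts) :
    polyRep c t z = GeneralLinearGroup.scalar (Fin 2)
      (Units.map (C : K →+* K[X]).toMonoidHom (character Γ t z)) := by
  refine MonoidHom.eqOn_closure (g := ((GeneralLinearGroup.scalar (Fin 2)).comp
    (Units.map (C : K →+* K[X]).toMonoidHom)).comp (character Γ t)) ?_ hz
  rintro _ ⟨v, hv, rfl⟩
  simp [polyRep, character, vertexMatrix_of_mem_universalVerts c t hv]

theorem polyRep_eq_torus {D : (deleteUniversal Γ).ConnectedComponent} {x : RAAG Γ}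
    (hx : x ∈ vertexSubgroup Γ (componentVerts D)) :
    polyRep c t x = SpecialLinearGroup.toGL (torus (c D) (character Γ t x)) := by
  refine MonoidHom.eqOn_closure
    (g := (SpecialLinearGroup.toGL.comp (torus (c D))).comp (character Γ t)) ?_ hx
  rintro _ ⟨v, hv, rfl⟩
  simp [polyRep, character, vertexMatrix_of_mem_componentVerts c t hv]

theorem polyRep_comp_freeProductHom :
    (polyRep c t).comp (freeProductHom Γ) = SpecialLinearGroup.toGL.comp
      (Monoid.CoprodI.lift fun D =>
        (torus (c D)).comp ((character Γ t).comp (Subgroup.subtype _))) :=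
  Monoid.CoprodI.ext_hom _ _ fun D => MonoidHom.ext fun x => by
    simpa [freeProductHom] using polyRep_eq_torus c t x.2

theorem det_polyRep_freeProductHom (g) :
    GeneralLinearGroup.det (polyRep c t (freeProductHom Γ g)) = 1 := by
  rw [← MonoidHom.comp_apply (polyRep c t), polyRep_comp_freeProductHom]
  exact Units.ext (by simp)

variable {c t}

theorem nontrivial_vertexSubgroup_componentVerts (ht : LinearIndependent ℤ (Additive.ofMul ∘ t))
    (D : (deleteUniversal Γ).ConnectedComponent) :
    Nontrivial (vertexSubgroup Γ (componentVerts D)) := by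
  obtain ⟨v, hv⟩ := D.nonempty_supp
  refine ⟨⟨gen Γ v, Subgroup.subset_closure ⟨v, ⟨v, hv, rfl⟩, rfl⟩⟩, 1, fun h => ?_⟩
  have hgen : gen Γ v = 1 := congrArg Subtype.val h
  have htv : t v = 1 := by simpa [character] using congrArg (character Γ t) hgen
  exact ht.ne_zero (v : V) (by simp [htv])

variable [Nontrivial (deleteUniversal Γ).ConnectedComponent] (hc : Function.Injective c)
  (ht : LinearIndependent ℤ (Additive.ofMul ∘ t))
  (hΓ : ∀ D : (deleteUniversal Γ).ConnectedComponent, (deleteUniversal Γ).IsClique D.supp)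

include hc ht hΓ

theorem polyRep_comp_freeProductHom_injective :
    Function.Injective ((polyRep c t).comp (freeProductHom Γ)) := by
  have := nontrivial_vertexSubgroup_componentVerts (Γ := Γ) ht
  rw [polyRep_comp_freeProductHom]
  refine SpecialLinearGroup.toGL_injective.comp <|
    coprodI_lift_torus_injective hc _ fun D x hx => Subtype.ext ?_
  exact eq_one_of_character_pow_eq_one ht (isClique_componentVerts (hΓ D)) x.2 two_ne_zero hx

theorem polyRep_injective : Function.Injective (polyRep c t) := by
  rw [injective_iff_map_eq_one]
  intro x hx
  obtain ⟨z, hz, g, rfl⟩ := exists_mul_freeProductHom_eq x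
  have hdet : character Γ t z ^ 2 = 1 := by
    have hdet := congrArg GeneralLinearGroup.det hx
    rw [map_mul, map_mul, det_polyRep_freeProductHom, mul_one, polyRep_eq_scalar c t hz,
      GeneralLinearGroup.det_scalar, Fintype.card_fin, ← map_pow, map_one] at hdet
    exact Units.map_injective C_injective (hdet.trans (map_one _).symm)
  obtain rfl : z = 1 :=
    eq_one_of_character_pow_eq_one ht Γ.isClique_universalVerts hz two_ne_zero hdet
  rw [one_mul] at hx ⊢
  rw [(injective_iff_map_eq_one _).1 (polyRep_comp_freeProductHom_injective hc ht hΓ) g hx, map_one]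

end Representation

section FaithfulRep

open Polynomial

variable {V : Type u} {Γ : SimpleGraph V}

theorem exists_hasFaithfulRep_one_top (V : Type u) [Small.{w} V] {p : ℕ} (hp : p = 0 ∨ p.Prime) :
    ∃ (F : Type w) (_ : Field F) (_ : CharP F p),
      HasFaithfulRep (RAAG (⊤ : SimpleGraph V)) F 1 := by
  obtain ⟨K, _, _, t, ht⟩ := exists_field_linearIndependent_units V hp
  refine ⟨K, inferInstance, inferInstance, hasFaithfulRep_one_iff.2 ⟨character ⊤ t, ?_⟩⟩
  rw [injective_iff_map_eq_one]
  intro x hx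
  have hmem : x ∈ vertexSubgroup (⊤ : SimpleGraph V) Set.univ := by
    rw [vertexSubgroup, Set.image_univ, PresentedGroup.closure_range_of]
    trivial
  exact eq_one_of_character_pow_eq_one ht (fun _ _ _ _ => id) hmem one_ne_zero (by rw [hx, one_pow])

theorem exists_hasFaithfulRep_two [Small.{w} V] (hne : Γ ≠ ⊤)
    (hΓ : ∀ C : (deleteUniversal Γ).ConnectedComponent, (deleteUniversal Γ).IsClique C.supp)
    {p : ℕ} (hp : p = 0 ∨ p.Prime) :
    ∃ (F : Type w) (_ : Field F) (_ : CharP F p), HasFaithfulRep (RAAG Γ) F 2 := by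
  obtain ⟨K, _, _, t, ht⟩ := exists_field_linearIndependent_units V hp
  have := (nontrivial_connectedComponent_deleteUniversal_iff hΓ).2 hne
  let c (C : (deleteUniversal Γ).ConnectedComponent) : K := t (Quot.out C).1
  have hc : Function.Injective c :=
    Units.val_injective.comp <| (ht.injective.comp Subtype.val_injective).comp
      (Function.LeftInverse.injective Quot.out_eq)
  exact ⟨FractionRing K[X], inferInstance,
    charP_of_injective_algebraMap (algebraMap K (FractionRing K[X])).injective p,
    hasFaithfulRep_fractionRing (polyRep_injective hc ht hΓ)⟩

theorem eq_top_of_hasFaithfulRep_one {F : Type*} [Field F] (h : HasFaithfulRep (RAAG Γ) F 1) :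
    Γ = ⊤ := by
  by_contra hne
  obtain ⟨v, w, hvw, hadj⟩ := SimpleGraph.ne_top_iff_exists_not_adj.1 hne
  exact not_commute_gen hvw hadj (h.commute _ _)

theorem isClique_supp_of_hasFaithfulRep_two {F : Type*} [Field F] (h : HasFaithfulRep (RAAG Γ) F 2)
    (C : (deleteUniversal Γ).ConnectedComponent) : (deleteUniversal Γ).IsClique C.supp := by
  refine isClique_supp_of_adj_trans (fun a b c hab hbc hac => ?_) C
  by_contra hadj
  refine b.2 (gen_mem_center_iff.1 ?_)
  exact h.mem_center_of_commute_of_not_commute (gen_commute (Γ := Γ) hab).symm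
    (gen_commute (Γ := Γ) hbc)
    (not_commute_gen (Subtype.coe_ne_coe.2 hac) hadj)

end FaithfulRep

end RAAG

section MinDim

theorem sInf_natCast_eq_iff_isLeast {P : ℕ → Prop} {n : ℕ} :
    sInf {x : ℕ∞ | ∃ d : ℕ, x = d ∧ P d} = n ↔ IsLeast {d | P d} n := by
  constructor
  · intro h
    have hne : {x : ℕ∞ | ∃ d : ℕ, x = d ∧ P d}.Nonempty := by
      by_contra! hempty
      rw [hempty, sInf_empty] at h
      exact ENat.top_ne_natCast n h
    obtain ⟨d, hd, hP⟩ := csInf_mem hne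
    obtain rfl : n = d := by exact_mod_cast h.symm.trans hd
    exact ⟨hP, fun m hm => by exact_mod_cast h.symm.trans_le (sInf_le ⟨m, rfl, hm⟩)⟩
  · rintro ⟨hn, hle⟩
    refine IsLeast.csInf_eq ⟨⟨n, rfl, hn⟩, ?_⟩
    rintro _ ⟨d, rfl, hd⟩
    exact_mod_cast hle hd

theorem isLeast_two_iff {P : ℕ → Prop} : IsLeast {d | 1 ≤ d ∧ P d} 2 ↔ P 2 ∧ ¬ P 1 := by
  refine ⟨fun h => ⟨h.1.2, fun h1 => absurd (h.2 ⟨le_rfl, h1⟩) (by norm_num)⟩, fun ⟨h2, h1⟩ =>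
    ⟨⟨one_le_two, h2⟩, fun d ⟨hd, hP⟩ => ?_⟩⟩
  have hd1 : d ≠ 1 := by rintro rfl; exact h1 hP
  lia

theorem sInf_pos_natCast_eq_two_iff {P : ℕ → Prop} :
    sInf {x : ℕ∞ | ∃ d : ℕ, x = d ∧ 1 ≤ d ∧ P d} = 2 ↔ P 2 ∧ ¬ P 1 :=
  sInf_natCast_eq_iff_isLeast.trans isLeast_two_iff

variable {V : Type u} [Small.{w} V] (Γ : SimpleGraph V)

theorem minDim_eq_two_iff :
    minDim.{w} (RAAG Γ) = 2 ↔ TwoOrMoreCompleteComponents (deleteUniversal Γ) := by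
  rw [minDim, sInf_pos_natCast_eq_two_iff, twoOrMoreCompleteComponents_deleteUniversal_iff]
  constructor
  · rintro ⟨⟨F, _, h2⟩, h1⟩
    refine ⟨?_, RAAG.isClique_supp_of_hasFaithfulRep_two h2⟩
    rintro rfl
    obtain ⟨K, _, -, hK⟩ := RAAG.exists_hasFaithfulRep_one_top V (Or.inl rfl)
    exact h1 ⟨K, _, hK⟩
  · rintro ⟨hne, hΓ⟩
    obtain ⟨K, _, -, hK⟩ := RAAG.exists_hasFaithfulRep_two hne hΓ (Or.inl rfl)
    exact ⟨⟨K, _, hK⟩, fun ⟨F, _, h1⟩ => hne (RAAG.eq_top_of_hasFaithfulRep_one h1)⟩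

theorem minDimChar_eq_two_iff {p : ℕ} (hp : p = 0 ∨ p.Prime) :
    minDimChar.{w} p (RAAG Γ) = 2 ↔ TwoOrMoreCompleteComponents (deleteUniversal Γ) := by
  rw [minDimChar, sInf_pos_natCast_eq_two_iff, twoOrMoreCompleteComponents_deleteUniversal_iff]
  constructor
  · rintro ⟨⟨F, _, _, h2⟩, h1⟩
    refine ⟨?_, RAAG.isClique_supp_of_hasFaithfulRep_two h2⟩
    rintro rfl
    exact h1 (RAAG.exists_hasFaithfulRep_one_top V hp)
  · rintro ⟨hne, hΓ⟩
    exact ⟨RAAG.exists_hasFaithfulRep_two hne hΓ hp,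
      fun ⟨F, _, _, h1⟩ => hne (RAAG.eq_top_of_hasFaithfulRep_one h1)⟩

end MinDim

theorem mainTheorem8_general {V : Type u} [Small.{w} V] (Γ : SimpleGraph V) :
    (minDim.{w} (RAAG Γ) = 2 ↔ TwoOrMoreCompleteComponents (deleteUniversal Γ)) ∧
    ((∀ p : ℕ, p = 0 ∨ p.Prime → minDimChar.{w} p (RAAG Γ) = 2) ↔
      TwoOrMoreCompleteComponents (deleteUniversal Γ)) ∧
    (∀ p : ℕ, p = 0 ∨ p.Prime →
      (minDimChar.{w} p (RAAG Γ) = 2 ↔ TwoOrMoreCompleteComponents (deleteUniversal Γ))) :=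
  ⟨minDim_eq_two_iff Γ,
    ⟨fun h => (minDimChar_eq_two_iff Γ (Or.inl rfl)).1 (h 0 (Or.inl rfl)),
      fun hΓ _ hp => (minDimChar_eq_two_iff Γ hp).2 hΓ⟩,
    fun _ => minDimChar_eq_two_iff Γ⟩

theorem mainTheorem8 {V : Type u} [Finite V] (Γ : SimpleGraph V) :
    (minDim.{w} (RAAG Γ) = 2 ↔ TwoOrMoreCompleteComponents (deleteUniversal Γ)) ∧
    ((∀ p : ℕ, p = 0 ∨ p.Prime → minDimChar.{w} p (RAAG Γ) = 2) ↔
      TwoOrMoreCompleteComponents (deleteUniversal Γ)) ∧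
    (∀ p : ℕ, p = 0 ∨ p.Prime →
      (minDimChar.{w} p (RAAG Γ) = 2 ↔ TwoOrMoreCompleteComponents (deleteUniversal Γ))) :=
  mainTheorem8_general.{w} Γ
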